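/- **Theorem (Continuity of the entanglement distance).** For unit vectors $\psi,\varphi$ in a complex Hilbert space let $d_{\mathrm{FS}}(\psi,\varphi)=\arccos|\langle\psi|\varphi\rangle|$ be the Fubini–Study distance. Let $\mathcal H_A,\mathcal H_B$ be finite-dimensional complex Hilbert spaces. For a unit vector $\psi\in\mathcal H_A\otimes\mathcal H_B$ let $E(\psi)=-\operatorname{Tr}(\rho_A\log\rho_A)$, where $\rho_A=\operatorname{Tr}_B|\psi\rangle\langle\psi|$, $\log$ is the natural logarithm and $0\log 0=0$, be the entanglement entropy. For unit vectors $\psi,\varphi\in\mathcal H_A\otimes\mathcal H_B$ put $$d_E(\psi,\varphi)=\sqrt{d_{\mathrm{FS}}(\psi,\varphi)^2+|E(\psi)-E(\varphi)|^2}.$$ There is a universal constant $C>0$, independent of the spaces and of the states, such that for all finite-dimensional $\mathcal H_A,\mathcal H_B$ and all unit vectors $\psi,\chi,\varphi\in\mathcal H_A\otimes\mathcal H_B$, $$|d_E(\psi,\varphi)-d_E(\chi,\varphi)|\le d_{\mathrm{FS}}(\psi,\chi)+C\,d_{\mathrm{FS}}(\psi,\chi)\log d,\qquad d=\min(\dim\mathcal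 H_A,\dim\mathcal H_B).$$ In particular, for fixed $\mathcal H_A,\mathcal H_B$, there is a constant $K\ge 0$ with $|d_E(\psi,\varphi)-d_E(\chi,\varphi)|\le K\,d_{\mathrm{FS}}(\psi,\chi)$ for all unit vectors $\psi,\chi,\varphi$; that is, $d_E(\cdot,\varphi)$ is Lipschitz with respect to $d_{\mathrm{FS}}$, uniformly in $\varphi$. -/

import Mathlib

open scoped TensorProduct

noncomputable section

namespace QuantumDistance

section FubiniStudy

variable {H : Type*} [NormedAddCommGroup H] [InnerProductSpace ℂ H]

/-- The Fubini–Study distance `arccos (|⟨ψ|φ⟩| / (‖ψ‖ ‖φ‖))` between the rays of `ψ` and `φ`. -/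
def dFS (ψ φ : H) : ℝ :=
  Real.arccos (‖inner ℂ ψ φ‖ / (‖ψ‖ * ‖φ‖))

end FubiniStudy

section Entropy

variable {H : Type*} [NormedAddCommGroup H] [InnerProductSpace ℂ H] [FiniteDimensional ℂ H]

/-- The von Neumann entropy `S(ρ) = -Tr (ρ log ρ)` (natural logarithm) of an operator on a
finite-dimensional Hilbert space. The logarithm is the one of the functional calculus with the
convention `log 0 = 0`, so that eigenvalue `0` contributes `0 * log 0 = 0`. -/
def vonNeumannEntropy (ρ : H →L[ℂ] H) : ℝ :=
  haveI : CompleteSpace H := FiniteDimensional.complete ℂ H;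
  -(LinearMap.trace ℂ H (ρ * CFC.log ρ : H →L[ℂ] H)).re

end Entropy

section Bipartite

variable {A B : Type*}
  [NormedAddCommGroup A] [InnerProductSpace ℂ A] [FiniteDimensional ℂ A]
  [NormedAddCommGroup B] [InnerProductSpace ℂ B] [FiniteDimensional ℂ B]

variable (A B) in
/-- The partial trace over the second factor: under `End (A ⊗ B) ≃ End A ⊗ End B` it is
`id ⊗ Tr`, that is, the linear map with `S ⊗ T ↦ Tr T • S`. -/
def partialTrace : (A ⊗[ℂ] B →ₗ[ℂ] A ⊗[ℂ] B) →ₗ[ℂ] (A →ₗ[ℂ] A) :=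
  (TensorProduct.rid ℂ (A →ₗ[ℂ] A)).toLinearMap ∘ₗ
    LinearMap.lTensor (A →ₗ[ℂ] A) (LinearMap.trace ℂ B) ∘ₗ
      (homTensorHomEquiv ℂ A B A B).symm.toLinearMap

theorem partialTrace_map (S : A →ₗ[ℂ] A) (T : B →ₗ[ℂ] B) :
    partialTrace A B (TensorProduct.map S T) = LinearMap.trace ℂ B T • S := by
  have h : (homTensorHomEquiv ℂ A B A B).symm (TensorProduct.map S T) = S ⊗ₜ[ℂ] T := by
    rw [LinearEquiv.symm_apply_eq, homTensorHomEquiv_apply]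
    rfl
  simp [partialTrace, h]

/-- The reduced state `ρ_A = Tr_B |ψ⟩⟨ψ|`. -/
def reducedState (ψ : A ⊗[ℂ] B) : A →L[ℂ] A :=
  LinearMap.toContinuousLinearMap
    (partialTrace A B (InnerProductSpace.rankOne ℂ ψ ψ).toLinearMap)

/-- The entanglement entropy `E(ψ) = S(Tr_B |ψ⟩⟨ψ|)` of a unit vector `ψ`. -/
def entanglement (ψ : A ⊗[ℂ] B) : ℝ :=
  vonNeumannEntropy (reducedState ψ)

/-- The entanglement distance `√(d_FS(ψ,φ)² + |E(ψ) - E(φ)|²)` of unit vectors. -/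
def dE (ψ φ : A ⊗[ℂ] B) : ℝ :=
  Real.sqrt (dFS ψ φ ^ 2 + |entanglement ψ - entanglement φ| ^ 2)

end Bipartite

end QuantumDistance

end

open scoped TensorProduct

namespace QuantumDistance

/-! ### Scalar estimates and the Shannon entropy of squared amplitudes -/

section Classical

/-! `dE` is the Euclidean norm of a pair in the plane, so everything reduces to the triangle
inequality for `dFS` and to `|E(ψ) - E(χ)| ≤ 40 θ log d`, where `θ = dFS ψ χ`.

Entropy is not Lipschitz in the probabilities, but it is in the amplitudes: `z ↦ negMulLog (z²)` has
slope of order `z (1 - log z)`, and for a unit vector of length `n` these weights have ℓ² norm `O(1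
+ log n)`. Cauchy–Schwarz gives `sum_negMulLog_sq_sub_le`.

To pass to states, measure both reduced states in an eigenbasis of that of `χ`. This computes `E(χ)`
exactly and can only increase the entropy of `ψ`, while the amplitude vectors have overlap at least
`|⟨ψ|χ⟩| = cos θ`. Exchanging the factors (`entanglement_comm`) replaces `dim A` by the minimum. -/

/-- `x ↦ x (1 - log x)` is monotone on `[0, 1]`. -/
theorem mul_one_sub_log_le {x y : ℝ} (hx : 0 ≤ x) (hxy : x ≤ y) (hy : y ≤ 1) :
    x * (1 - Real.log x) ≤ y * (1 - Real.log y) := by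
  rcases hx.eq_or_lt with rfl | hx
  · have := Real.log_nonpos hxy hy
    rw [zero_mul]
    exact mul_nonneg hxy (by linarith)
  · have hy0 : 0 < y := hx.trans_le hxy
    have h1 : Real.log y - Real.log x ≤ y / x - 1 := by
      rw [← Real.log_div hy0.ne' hx.ne']
      exact Real.log_le_sub_one_of_pos (div_pos hy0 hx)
    have h2 : x * (Real.log y - Real.log x) ≤ y - x := by
      calc x * (Real.log y - Real.log x) ≤ x * (y / x - 1) :=
            mul_le_mul_of_nonneg_left h1 hx.le
        _ = y - x := by field_simp
    have h3 : (y - x) * Real.log y ≤ 0 :=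
      mul_nonpos_of_nonneg_of_nonpos (by linarith) (Real.log_nonpos hy0.le hy)
    nlinarith

/-- Mean value inequality, with the slope bound taken at the larger endpoint by monotonicity of `z
(1 - log z)`. The case `x = 0` is separate because `negMulLog` is not differentiable there. -/
theorem abs_negMulLog_sq_sub_le_of_le {x y : ℝ} (hx : 0 ≤ x) (hxy : x ≤ y) (hy : y ≤ 1) :
    |Real.negMulLog (y ^ 2) - Real.negMulLog (x ^ 2)| ≤
      4 * (y * (1 - Real.log y)) * (y - x) := by
  rcases hx.eq_or_lt with rfl | hx
  · have hl := Real.log_nonpos hxy hy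
    have he : Real.negMulLog (y ^ 2) - Real.negMulLog (0 ^ 2) = y ^ 2 * (2 * -Real.log y) := by
      simp [Real.negMulLog, Real.log_pow]
    rw [he, abs_of_nonneg (mul_nonneg (sq_nonneg y) (by linarith))]
    nlinarith [mul_nonneg (sq_nonneg y) (neg_nonneg.2 hl), sq_nonneg y]
  · have hd : ∀ z ∈ Set.Icc x y, HasDerivWithinAt (fun z : ℝ => Real.negMulLog (z ^ 2))
        ((-Real.log (z ^ 2) - 1) * (2 * z)) (Set.Icc x y) z := by
      intro z hz
      have hz0 : 0 < z := hx.trans_le hz.1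
      have h := HasDerivAt.comp (h := fun z : ℝ => z ^ 2) z
        (Real.hasDerivAt_negMulLog (pow_pos hz0 2).ne') (hasDerivAt_pow 2 z)
      simpa [Function.comp_def] using h.hasDerivWithinAt
    have hb : ∀ z ∈ Set.Icc x y, ‖(-Real.log (z ^ 2) - 1) * (2 * z)‖ ≤
        4 * (y * (1 - Real.log y)) := by
      intro z hz
      have hz0 : 0 < z := hx.trans_le hz.1
      have hk := mul_one_sub_log_le hz0.le hz.2 hy
      have hl := Real.log_nonpos hz0.le (hz.2.trans hy)
      rw [Real.norm_eq_abs, Real.log_pow, abs_le]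
      push_cast
      constructor <;> nlinarith
    have := (convex_Icc x y).norm_image_sub_le_of_norm_hasDerivWithin_le hd hb
      (Set.left_mem_Icc.2 hxy) (Set.right_mem_Icc.2 hxy)
    simpa [Real.norm_eq_abs, abs_of_nonneg (sub_nonneg.2 hxy)] using this

theorem abs_negMulLog_sq_sub_le {x y : ℝ} (hx : 0 ≤ x) (hx1 : x ≤ 1) (hy : 0 ≤ y) (hy1 : y ≤ 1) :
    |Real.negMulLog (x ^ 2) - Real.negMulLog (y ^ 2)| ≤
      4 * (|x - y| * (x * (1 - Real.log x) + y * (1 - Real.log y))) := by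
  have hkx : 0 ≤ x * (1 - Real.log x) :=
    mul_nonneg hx (by linarith [Real.log_nonpos hx hx1])
  have hky : 0 ≤ y * (1 - Real.log y) :=
    mul_nonneg hy (by linarith [Real.log_nonpos hy hy1])
  rcases le_total x y with h | h
  · have := abs_negMulLog_sq_sub_le_of_le hx h hy1
    rw [abs_sub_comm, abs_sub_comm x y, abs_of_nonneg (sub_nonneg.2 h)]
    nlinarith [mul_nonneg (sub_nonneg.2 h) hkx]
  · have := abs_negMulLog_sq_sub_le_of_le hy h hx1
    rw [abs_of_nonneg (sub_nonneg.2 h)]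
    nlinarith [mul_nonneg (sub_nonneg.2 h) hky]

variable {ι : Type*} [Fintype ι]

theorem le_one_of_sum_sq_eq_one {s : ι → ℝ} (h : ∑ i, s i ^ 2 = 1) (i : ι) : s i ≤ 1 := by
  have := Finset.single_le_sum (f := fun i => s i ^ 2) (fun i _ => sq_nonneg _)
    (Finset.mem_univ i)
  simp only [h] at this
  nlinarith

/-- For a unit vector `s`, the vector `s (1 - log s)` has norm at most `√2 (1 + log n)`. -/
theorem sum_sq_mul_one_sub_log_le {s : ι → ℝ} (h0 : ∀ i, 0 ≤ s i) (h : ∑ i, s i ^ 2 = 1) :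
    ∑ i, (s i * (1 - Real.log (s i))) ^ 2 ≤ 2 * (1 + Real.log (Fintype.card ι)) ^ 2 := by
  have hne : Nonempty ι := by
    by_contra hc
    rw [not_nonempty_iff] at hc
    simp at h
  have hn : (1 : ℝ) ≤ Fintype.card ι := by exact_mod_cast Fintype.card_pos
  set n : ℝ := (Fintype.card ι : ℝ) with hn_def
  have hn0 : 0 < n := by linarith
  have hL : 0 ≤ Real.log n := Real.log_nonneg hn
  -- Split at `s i = 1 / n`: small entries are bounded by monotonicity, large ones by `-log (s i) ≤
  -- log n`. Each kind contributes at most `(1 + log n)²` in total.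
  have key : ∀ i, (s i * (1 - Real.log (s i))) ^ 2 ≤
      s i ^ 2 * (1 + Real.log n) ^ 2 + (1 + Real.log n) ^ 2 / n := by
    intro i
    have h1 := le_one_of_sum_sq_eq_one h i
    have hl := Real.log_nonpos (h0 i) h1
    rcases le_total (s i) (1 / n) with hi | hi
    · have hk := mul_one_sub_log_le (h0 i) hi ((div_le_one hn0).2 hn)
      rw [one_div, Real.log_inv, sub_neg_eq_add] at hk
      have h2 : (s i * (1 - Real.log (s i))) ^ 2 ≤ (n⁻¹ * (1 + Real.log n)) ^ 2 :=
        pow_le_pow_left₀ (mul_nonneg (h0 i) (by linarith)) hk 2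
      have h3 : (n⁻¹ * (1 + Real.log n)) ^ 2 ≤ (1 + Real.log n) ^ 2 / n := by
        rw [mul_pow, div_eq_inv_mul]
        refine mul_le_mul_of_nonneg_right ?_ (sq_nonneg _)
        rw [sq]
        exact mul_le_of_le_one_left (inv_nonneg.2 hn0.le) (inv_le_one_of_one_le₀ hn)
      have h4 : 0 ≤ s i ^ 2 * (1 + Real.log n) ^ 2 := by positivity
      linarith
    · have h2 : -Real.log n ≤ Real.log (s i) := by
        rw [← Real.log_inv, ← one_div]
        exact Real.log_le_log (by positivity) hi
      have h3 : (1 - Real.log (s i)) ^ 2 ≤ (1 + Real.log n) ^ 2 :=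
        pow_le_pow_left₀ (by linarith) (by linarith) 2
      have h4 : 0 ≤ (1 + Real.log n) ^ 2 / n := by positivity
      rw [mul_pow]
      nlinarith [mul_le_mul_of_nonneg_left h3 (sq_nonneg (s i))]
  calc _ ≤ ∑ i, (s i ^ 2 * (1 + Real.log n) ^ 2 + (1 + Real.log n) ^ 2 / n) :=
        Finset.sum_le_sum fun i _ => key i
    _ = 2 * (1 + Real.log n) ^ 2 := by
        rw [Finset.sum_add_distrib, ← Finset.sum_mul, h, Finset.sum_const, Finset.card_univ,
          nsmul_eq_mul, ← hn_def]
        field_simp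
        ring

/-- The Shannon entropy of `s²` is Lipschitz in the unit vector `s`, with a constant of the order
of the logarithm of the dimension. -/
theorem sum_negMulLog_sq_sub_le {s t : ι → ℝ} (hs0 : ∀ i, 0 ≤ s i) (ht0 : ∀ i, 0 ≤ t i)
    (hs : ∑ i, s i ^ 2 = 1) (ht : ∑ i, t i ^ 2 = 1) {θ : ℝ} (hθ : 0 ≤ θ)
    (hst : Real.cos θ ≤ ∑ i, s i * t i) :
    ∑ i, Real.negMulLog (s i ^ 2) - ∑ i, Real.negMulLog (t i ^ 2) ≤
      40 * θ * Real.log (Fintype.card ι) := by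
  have hne : Nonempty ι := by
    by_contra hc
    rw [not_nonempty_iff] at hc
    simp at hs
  -- For a single outcome the right side is `0`, but both entropies vanish.
  rcases (Nat.succ_le_of_lt (Fintype.card_pos (α := ι))).eq_or_lt with h1 | h2
  · have hsub : Subsingleton ι := Fintype.card_le_one_iff_subsingleton.1 h1.ge
    obtain ⟨i⟩ := hne
    have hu : (Finset.univ : Finset ι) = {i} := by
      ext j; simp [Subsingleton.elim j i]
    simp only [hu, Finset.sum_singleton] at hs ht ⊢
    rw [hs, ht, ← h1]
    simp
  set L := Real.log (Fintype.card ι) with hL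
  -- Exactly what turns the final `16 θ (1 + L)` into `40 θ L`.
  have hL2 : (2 / 3 : ℝ) ≤ L := by
    have : Real.log 2 ≤ L := Real.log_le_log (by norm_num) (by exact_mod_cast h2)
    linarith [Real.log_two_gt_d9]
  have hdist : ∑ i, |s i - t i| ^ 2 ≤ θ ^ 2 := by
    have : ∑ i, |s i - t i| ^ 2 = ∑ i, s i ^ 2 + ∑ i, t i ^ 2 - 2 * ∑ i, s i * t i := by
      rw [Finset.mul_sum, ← Finset.sum_add_distrib, ← Finset.sum_sub_distrib]
      refine Finset.sum_congr rfl fun i _ => ?_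
      rw [sq_abs]
      ring
    rw [this, hs, ht]
    linarith [Real.one_sub_sq_div_two_le_cos (x := θ)]
  have hcs : ∀ u : ι → ℝ, (∀ i, 0 ≤ u i) → ∑ i, u i ^ 2 = 1 →
      ∑ i, |s i - t i| * (u i * (1 - Real.log (u i))) ≤ θ * (2 * (1 + L)) := by
    intro u hu0 hu
    have hk := sum_sq_mul_one_sub_log_le hu0 hu
    refine abs_le_of_sq_le_sq' ?_ (by positivity) |>.2
    calc _ ≤ (∑ i, |s i - t i| ^ 2) * ∑ i, (u i * (1 - Real.log (u i))) ^ 2 :=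
          Finset.sum_mul_sq_le_sq_mul_sq _ _ _
      _ ≤ θ ^ 2 * (2 * (1 + L) ^ 2) :=
          mul_le_mul hdist hk (Finset.sum_nonneg fun _ _ => sq_nonneg _) (sq_nonneg _)
      _ ≤ (θ * (2 * (1 + L))) ^ 2 := by nlinarith [sq_nonneg (θ * (1 + L))]
  rw [← Finset.sum_sub_distrib]
  calc _ ≤ ∑ i, 4 * (|s i - t i| *
          (s i * (1 - Real.log (s i)) + t i * (1 - Real.log (t i)))) :=
        Finset.sum_le_sum fun i _ => (le_abs_self _).trans
          (abs_negMulLog_sq_sub_le (hs0 i) (le_one_of_sum_sq_eq_one hs i) (ht0 i)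
            (le_one_of_sum_sq_eq_one ht i))
    _ = 4 * (∑ i, |s i - t i| * (s i * (1 - Real.log (s i))) +
          ∑ i, |s i - t i| * (t i * (1 - Real.log (t i)))) := by
        rw [← Finset.sum_add_distrib, ← Finset.mul_sum]
        simp only [mul_add]
    _ ≤ 4 * (θ * (2 * (1 + L)) + θ * (2 * (1 + L))) := by
        gcongr
        · exact hcs s hs0 hs
        · exact hcs t ht0 ht
    _ ≤ 40 * θ * L := by nlinarith

/-- The Euclidean norm of the plane satisfies the triangle inequality. -/
theorem abs_sqrt_sq_add_sq_sub_le (a b c d : ℝ) :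
    |√(a ^ 2 + b ^ 2) - √(c ^ 2 + d ^ 2)| ≤ |a - c| + |b - d| := by
  have h (a b : ℝ) : √(a ^ 2 + b ^ 2) = ‖(⟨a, b⟩ : ℂ)‖ := by
    rw [Complex.norm_def, Complex.normSq_mk, sq, sq]
  rw [h, h]
  exact (abs_norm_sub_norm_le _ _).trans (Complex.norm_le_abs_re_add_abs_im _)

end Classical

/-! ### Triangle inequality for the Fubini–Study distance -/

section FubiniStudyTriangle

variable {H : Type*} [NormedAddCommGroup H] [InnerProductSpace ℂ H]

theorem dFS_eq {ψ φ : H} (hψ : ‖ψ‖ = 1) (hφ : ‖φ‖ = 1) :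
    dFS ψ φ = Real.arccos ‖inner ℂ ψ φ‖ := by
  rw [dFS, hψ, hφ, mul_one, div_one]

theorem dFS_comm (ψ φ : H) : dFS ψ φ = dFS φ ψ := by
  rw [dFS, dFS, norm_inner_symm, mul_comm ‖ψ‖]

theorem dFS_nonneg (ψ φ : H) : 0 ≤ dFS ψ φ := Real.arccos_nonneg _

theorem cos_dFS {ψ φ : H} (hψ : ‖ψ‖ = 1) (hφ : ‖φ‖ = 1) :
    Real.cos (dFS ψ φ) = ‖inner ℂ ψ φ‖ := by
  rw [dFS_eq hψ hφ, Real.cos_arccos]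
  · linarith [norm_nonneg (inner ℂ ψ φ)]
  · simpa [hψ, hφ] using norm_inner_le_norm (𝕜 := ℂ) ψ φ

/-- A phase can be chosen so that the inner product becomes its own absolute value. -/
theorem exists_norm_eq_one_inner_smul_eq (ψ φ : H) :
    ∃ c : ℂ, ‖c‖ = 1 ∧ inner ℂ ψ (c • φ) = (‖inner ℂ ψ φ‖ : ℂ) := by
  obtain ⟨c, hc, h⟩ := RCLike.exists_norm_eq_mul_self (inner ℂ ψ φ : ℂ)
  exact ⟨c, hc, by rw [inner_smul_right]; exact h.symm⟩

/-- Phases making both overlaps with `χ` real and nonnegative turn the two distances on the right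
into real angles; the remaining angle dominates `dFS ψ φ` because `Re z ≤ |z|`. -/
theorem dFS_triangle {ψ χ φ : H} (hψ : ‖ψ‖ = 1) (hχ : ‖χ‖ = 1) (hφ : ‖φ‖ = 1) :
    dFS ψ φ ≤ dFS ψ χ + dFS χ φ := by
  let _ : InnerProductSpace ℝ H := InnerProductSpace.rclikeToReal ℂ H
  obtain ⟨c, hc, hcψ⟩ := exists_norm_eq_one_inner_smul_eq χ ψ
  obtain ⟨e, he, heφ⟩ := exists_norm_eq_one_inner_smul_eq χ φ
  have hψ' : ‖c • ψ‖ = 1 := by rw [norm_smul, hc, hψ, mul_one]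
  have hφ' : ‖e • φ‖ = 1 := by rw [norm_smul, he, hφ, mul_one]
  have h := InnerProductGeometry.angle_le_angle_add_angle (c • ψ) χ (e • φ)
  have hr (x y : H) : inner ℝ x y = (inner ℂ x y).re := rfl
  rw [InnerProductGeometry.angle_comm _ χ] at h
  simp only [InnerProductGeometry.angle, hψ', hφ', hχ, hr, hcψ, heφ, Complex.ofReal_re, mul_one,
    div_one] at h
  rw [dFS_comm ψ χ, dFS_eq hχ hψ, dFS_eq hχ hφ, dFS_eq hψ hφ]
  refine le_trans (Real.arccos_le_arccos ?_) h
  refine (Complex.re_le_norm _).trans ?_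
  rw [inner_smul_left, inner_smul_right, norm_mul, norm_mul, RCLike.norm_conj, hc, he, one_mul,
    one_mul]

end FubiniStudyTriangle

/-! ### Von Neumann entropy through eigenvalues -/

section Entropy

variable {H : Type*} [NormedAddCommGroup H] [InnerProductSpace ℂ H] [FiniteDimensional ℂ H]

theorem finite_real_spectrum (ρ : H →L[ℂ] H) : (spectrum ℝ ρ).Finite := by
  have : CompleteSpace H := FiniteDimensional.complete ℂ H
  have h : (spectrum ℂ ρ).Finite := by
    refine (Module.End.finite_spectrum (ρ : H →ₗ[ℂ] H)).subset fun z hz hu => hz ?_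
    exact ContinuousLinearMap.isUnit_iff_bijective.2 ((Module.End.isUnit_iff _).1 hu)
  rw [← spectrum.preimage_algebraMap ℂ]
  exact h.preimage (FaithfulSMul.algebraMap_injective ℝ ℂ).injOn

/-- The functional calculus acts on eigenvectors through the eigenvalue. -/
theorem cfc_apply_of_apply_eq_smul [CompleteSpace H] (f : ℝ → ℝ) {ρ : H →L[ℂ] H} (hρ : IsSelfAdjoint ρ) {μ : ℝ}
    {v : H} (hv : ρ v = (μ : ℂ) • v) : cfc f ρ v = (f μ : ℂ) • v := by
  rcases eq_or_ne v 0 with rfl | hv0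
  · simp
  have hμ : μ ∈ spectrum ℝ ρ := by
    intro hu
    refine hv0 ((ContinuousLinearMap.isUnit_iff_bijective.1 hu).1 ?_)
    simp [Algebra.algebraMap_eq_smul_one, hv]
  -- On the finite spectrum `f` agrees with a polynomial, whose action on an eigenvector is
  -- explicit.
  let S : Finset ℝ := (finite_real_spectrum ρ).toFinset
  let q : Polynomial ℝ := Lagrange.interpolate S id f
  have hq : ∀ x ∈ spectrum ℝ ρ, q.eval x = f x := fun x hx =>
    Lagrange.eval_interpolate_at_node f (Function.injective_id.injOn)
      ((finite_real_spectrum ρ).mem_toFinset.2 hx)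
  have h1 : cfc f ρ = Polynomial.aeval ρ q := by
    rw [← cfc_polynomial q ρ hρ]
    exact cfc_congr fun x hx => (hq x hx).symm
  have h2 : ∀ p : Polynomial ℝ, (Polynomial.aeval ρ p) v = ((p.eval μ : ℝ) : ℂ) • v := by
    intro p
    induction p using Polynomial.induction_on with
    | C a => simp [Algebra.algebraMap_eq_smul_one]
    | add p q hp hq => simp [hp, hq, add_smul]
    | monomial n a h =>
      rw [pow_succ, ← mul_assoc, map_mul, Polynomial.aeval_X, mul_apply_eq_comp, hv,
        map_smul, h, smul_smul, Polynomial.eval_mul_X, Complex.ofReal_mul, mul_comm]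
  rw [h1, h2, hq μ hμ]

theorem vonNeumannEntropy_eq_sum {ι : Type*} [Fintype ι] {ρ : H →L[ℂ] H}
    (hρ : (ρ : H →ₗ[ℂ] H).IsSymmetric) (e : OrthonormalBasis ι ℂ H) {μ : ι → ℝ}
    (he : ∀ i, ρ (e i) = (μ i : ℂ) • e i) :
    vonNeumannEntropy ρ = ∑ i, Real.negMulLog (μ i) := by
  have : CompleteSpace H := FiniteDimensional.complete ℂ H
  have hsa : IsSelfAdjoint ρ := ContinuousLinearMap.isSelfAdjoint_iff_isSymmetric.2 hρ
  have hlog (i : ι) : (ρ * CFC.log ρ) (e i) = ((μ i * Real.log (μ i) : ℝ) : ℂ) • e i := by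
    rw [mul_apply_eq_comp, CFC.log, cfc_apply_of_apply_eq_smul _ hsa (he i), map_smul,
      he, smul_smul, Complex.ofReal_mul, mul_comm]
  rw [vonNeumannEntropy, LinearMap.trace_eq_sum_inner _ e, Complex.re_sum, ← Finset.sum_neg_distrib]
  refine Finset.sum_congr rfl fun i _ => ?_
  rw [ContinuousLinearMap.coe_coe, hlog, inner_smul_right, inner_self_eq_norm_sq_to_K,
    e.norm_eq_one, Real.negMulLog]
  simp

/-- Measuring a positive operator in an orthonormal basis does not decrease its entropy. -/
theorem vonNeumannEntropy_le_sum {ι : Type*} [Fintype ι] {ρ : H →L[ℂ] H}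
    (hρ : (ρ : H →ₗ[ℂ] H).IsPositive) (a : OrthonormalBasis ι ℂ H) :
    vonNeumannEntropy ρ ≤ ∑ i, Real.negMulLog (inner ℂ (a i) (ρ (a i))).re := by
  let e := hρ.isSymmetric.eigenvectorBasis rfl
  let μ := hρ.isSymmetric.eigenvalues rfl
  have he (k) : ρ (e k) = (μ k : ℂ) • e k := hρ.isSymmetric.apply_eigenvectorBasis rfl k
  have hμ (k) : 0 ≤ μ k := hρ.nonneg_eigenvalues rfl k
  rw [vonNeumannEntropy_eq_sum hρ.isSymmetric e he]
  -- The diagonal is a doubly stochastic average of the eigenvalues: Jensen uses that the weights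
  -- sum to one over `k`, the last computation that they do over `i`.
  have hdiag (i : ι) : (inner ℂ (a i) (ρ (a i))).re = ∑ k, ‖inner ℂ (e k) (a i)‖ ^ 2 * μ k := by
    have h1 : ρ (a i) = ∑ k, inner ℂ (e k) (a i) • (μ k : ℂ) • e k := by
      conv_lhs => rw [← e.sum_repr' (a i)]
      simp [he]
    rw [h1, inner_sum, Complex.re_sum]
    refine Finset.sum_congr rfl fun k _ => ?_
    rw [inner_smul_right, inner_smul_right, mul_left_comm, ← inner_conj_symm (a i),
      Complex.mul_conj', mul_comm]
    norm_cast
  have hjensen (i : ι) : ∑ k, ‖inner ℂ (e k) (a i)‖ ^ 2 * Real.negMulLog (μ k) ≤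
      Real.negMulLog (inner ℂ (a i) (ρ (a i))).re := by
    rw [hdiag]
    refine Real.concaveOn_negMulLog.le_map_sum (fun k _ => sq_nonneg _) ?_ (fun k _ => hμ k)
    rw [e.sum_sq_norm_inner_right, a.norm_eq_one, one_pow]
  calc ∑ k, Real.negMulLog (μ k)
      = ∑ k, ∑ i, ‖inner ℂ (e k) (a i)‖ ^ 2 * Real.negMulLog (μ k) := by
        refine Finset.sum_congr rfl fun k _ => ?_
        rw [← Finset.sum_mul, a.sum_sq_norm_inner_left, e.norm_eq_one, one_pow, one_mul]
    _ = ∑ i, ∑ k, ‖inner ℂ (e k) (a i)‖ ^ 2 * Real.negMulLog (μ k) := Finset.sum_comm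
    _ ≤ _ := Finset.sum_le_sum fun i _ => hjensen i

/-- The entropy of a symmetric operator in terms of its characteristic polynomial. -/
theorem vonNeumannEntropy_eq_sum_roots {ρ : H →L[ℂ] H} (hρ : (ρ : H →ₗ[ℂ] H).IsSymmetric) :
    vonNeumannEntropy ρ =
      ((ρ : H →ₗ[ℂ] H).charpoly.roots.map fun z : ℂ => Real.negMulLog z.re).sum := by
  rw [vonNeumannEntropy_eq_sum hρ (hρ.eigenvectorBasis rfl) (hρ.apply_eigenvectorBasis rfl),
    hρ.roots_charpoly_eq_eigenvalues rfl, Multiset.map_map]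
  simp [Finset.sum]

end Entropy

/-! ### Coefficient matrices of bipartite vectors -/

section CoeffMatrix

variable {A B : Type*} [NormedAddCommGroup A] [InnerProductSpace ℂ A]
  [NormedAddCommGroup B] [InnerProductSpace ℂ B] {ι κ : Type*} [Fintype ι] [Fintype κ]

/-- The coefficient matrix of a bipartite vector in a pair of orthonormal bases. -/
noncomputable def coeffMatrix (a : OrthonormalBasis ι ℂ A) (b : OrthonormalBasis κ ℂ B) (ψ : A ⊗[ℂ] B) :
    Matrix ι κ ℂ :=
  Matrix.of fun i j => inner ℂ (a i ⊗ₜ[ℂ] b j) ψ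

theorem coeffMatrix_comm (a : OrthonormalBasis ι ℂ A) (b : OrthonormalBasis κ ℂ B)
    (ψ : A ⊗[ℂ] B) :
    coeffMatrix b a (TensorProduct.comm ℂ A B ψ) = (coeffMatrix a b ψ).transpose := by
  ext i j
  simp only [coeffMatrix, Matrix.of_apply, Matrix.transpose_apply]
  rw [← TensorProduct.comm_tmul, TensorProduct.inner_comm_comm]

end CoeffMatrix

/-! ### Reduced states and continuity of the entanglement entropy -/

section ReducedState

variable {A B : Type*}
  [NormedAddCommGroup A] [InnerProductSpace ℂ A] [FiniteDimensional ℂ A]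
  [NormedAddCommGroup B] [InnerProductSpace ℂ B] [FiniteDimensional ℂ B]
  {ι κ : Type*} [Fintype ι] [Fintype κ]

/-- Both sides are linear in `T`, so product operators suffice. -/
theorem inner_partialTrace (b : OrthonormalBasis κ ℂ B) (T : A ⊗[ℂ] B →ₗ[ℂ] A ⊗[ℂ] B) (x y : A) :
    inner ℂ x (partialTrace A B T y) = ∑ j, inner ℂ (x ⊗ₜ[ℂ] b j) (T (y ⊗ₜ[ℂ] b j)) := by
  obtain ⟨t, rfl⟩ := (homTensorHomEquiv ℂ A B A B).surjective T
  induction t with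
  | zero => simp
  | add t u ht hu => simp only [map_add, LinearMap.add_apply, inner_add_right, ht, hu,
      Finset.sum_add_distrib]
  | tmul S R =>
    have h : homTensorHomEquiv ℂ A B A B (S ⊗ₜ[ℂ] R) = TensorProduct.map S R := by
      rw [homTensorHomEquiv_apply]
      rfl
    rw [h, partialTrace_map, LinearMap.smul_apply, inner_smul_right,
      LinearMap.trace_eq_sum_inner R b, Finset.sum_mul]
    refine Finset.sum_congr rfl fun j _ => ?_
    rw [TensorProduct.map_tmul, TensorProduct.inner_tmul, mul_comm]

theorem inner_reducedState (b : OrthonormalBasis κ ℂ B) (ψ : A ⊗[ℂ] B) (x y : A) :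
    inner ℂ x (reducedState ψ y) =
      ∑ j, inner ℂ (x ⊗ₜ[ℂ] b j) ψ * inner ℂ ψ (y ⊗ₜ[ℂ] b j) := by
  have := inner_partialTrace b (InnerProductSpace.rankOne ℂ ψ ψ).toLinearMap x y
  refine this.trans (Finset.sum_congr rfl fun j _ => ?_)
  simp [inner_smul_right, mul_comm]

theorem isPositive_reducedState (ψ : A ⊗[ℂ] B) : (reducedState ψ : A →ₗ[ℂ] A).IsPositive := by
  have b := stdOrthonormalBasis ℂ B
  refine ⟨fun x y => ?_, fun x => ?_⟩
  · rw [← inner_conj_symm]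
    simp only [ContinuousLinearMap.coe_coe]
    rw [inner_reducedState b, inner_reducedState b, map_sum]
    refine Finset.sum_congr rfl fun j _ => ?_
    rw [map_mul, mul_comm]
    congr 1 <;> exact inner_conj_symm (𝕜 := ℂ) (E := A ⊗[ℂ] B) _ _
  · simp only [ContinuousLinearMap.coe_coe]
    rw [← inner_conj_symm, inner_reducedState b, RCLike.conj_re, map_sum]
    refine Finset.sum_nonneg fun j _ => ?_
    rw [← inner_conj_symm ψ, RCLike.mul_conj]
    norm_cast
    positivity

theorem inner_reducedState_self (b : OrthonormalBasis κ ℂ B) (ψ : A ⊗[ℂ] B) (x : A) :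
    (inner ℂ x (reducedState ψ x)).re = ∑ j, ‖inner ℂ (x ⊗ₜ[ℂ] b j) ψ‖ ^ 2 := by
  rw [inner_reducedState b, Complex.re_sum]
  refine Finset.sum_congr rfl fun j _ => ?_
  rw [← inner_conj_symm ψ, RCLike.mul_conj]
  norm_cast

theorem toMatrix_reducedState [DecidableEq ι] (a : OrthonormalBasis ι ℂ A)
    (b : OrthonormalBasis κ ℂ B) (ψ : A ⊗[ℂ] B) :
    LinearMap.toMatrix a.toBasis a.toBasis (reducedState ψ : A →ₗ[ℂ] A) =
      coeffMatrix a b ψ * (coeffMatrix a b ψ).conjTranspose := by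
  ext i j
  rw [LinearMap.toMatrix_apply, Matrix.mul_apply]
  simp only [OrthonormalBasis.coe_toBasis, OrthonormalBasis.coe_toBasis_repr_apply,
    OrthonormalBasis.repr_apply_apply, ContinuousLinearMap.coe_coe]
  rw [inner_reducedState b]
  refine Finset.sum_congr rfl fun k _ => ?_
  rw [← inner_conj_symm ψ]
  rfl

/-- The two reduced states of a bipartite vector have the same entropy. -/
theorem entanglement_comm (ψ : A ⊗[ℂ] B) :
    entanglement (TensorProduct.comm ℂ A B ψ) = entanglement ψ := by
  let a := stdOrthonormalBasis ℂ A
  let b := stdOrthonormalBasis ℂ B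
  -- The reduced states have matrices `M M*` and `(M* M)ᵀ`. Their characteristic polynomials agree
  -- up to powers of `X`, and the extra zero roots contribute `negMulLog 0 = 0`.
  set M := coeffMatrix a b ψ with hM
  have hA : (reducedState ψ : A →ₗ[ℂ] A).charpoly = (M * M.conjTranspose).charpoly := by
    rw [← LinearMap.charpoly_toMatrix _ a.toBasis, toMatrix_reducedState a b]
  have hB : (reducedState (TensorProduct.comm ℂ A B ψ) : B →ₗ[ℂ] B).charpoly =
      (M.conjTranspose * M).charpoly := by
    rw [← LinearMap.charpoly_toMatrix _ b.toBasis, toMatrix_reducedState b a, coeffMatrix_comm,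
      ← hM, ← Matrix.charpoly_transpose, Matrix.transpose_mul, Matrix.transpose_transpose]
    rfl
  have h := congrArg (fun p : Polynomial ℂ => (p.roots.map fun z : ℂ => Real.negMulLog z.re).sum)
    (Matrix.charpoly_mul_comm' M M.conjTranspose)
  have hX (n : ℕ) {p : Polynomial ℂ} (hp : p ≠ 0) :
      ((Polynomial.X ^ n * p).roots.map fun z : ℂ => Real.negMulLog z.re).sum =
        (p.roots.map fun z : ℂ => Real.negMulLog z.re).sum := by
    rw [Polynomial.roots_mul (mul_ne_zero (pow_ne_zero _ Polynomial.X_ne_zero) hp),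
      Polynomial.roots_X_pow, Multiset.map_add, Multiset.sum_add,
      Multiset.map_nsmul, Multiset.sum_nsmul]
    simp
  rw [hX _ (Matrix.charpoly_monic _).ne_zero, hX _ (Matrix.charpoly_monic _).ne_zero] at h
  rw [entanglement, entanglement,
    vonNeumannEntropy_eq_sum_roots (isPositive_reducedState _).isSymmetric,
    vonNeumannEntropy_eq_sum_roots (isPositive_reducedState _).isSymmetric, hA, hB, h]

theorem entanglement_sub_le_finrank_left {ψ χ : A ⊗[ℂ] B} (hψ : ‖ψ‖ = 1) (hχ : ‖χ‖ = 1) :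
    entanglement ψ - entanglement χ ≤ 40 * dFS ψ χ * Real.log (Module.finrank ℂ A) := by
  have hpos := isPositive_reducedState χ
  let a := hpos.isSymmetric.eigenvectorBasis rfl
  let b := stdOrthonormalBasis ℂ B
  let w (φ : A ⊗[ℂ] B) (i) : ℝ := √(inner ℂ (a i) (reducedState φ (a i))).re
  have hw2 (φ : A ⊗[ℂ] B) (i) : w φ i ^ 2 = (inner ℂ (a i) (reducedState φ (a i))).re := by
    refine Real.sq_sqrt ?_
    rw [inner_reducedState_self b]
    positivity
  have hwsum (φ : A ⊗[ℂ] B) (hφ : ‖φ‖ = 1) : ∑ i, w φ i ^ 2 = 1 := by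
    simp only [hw2, inner_reducedState_self b]
    have := (a.tensorProduct b).sum_sq_norm_inner_right φ
    rw [Fintype.sum_prod_type, hφ, one_pow] at this
    simpa using this
  have hχE : entanglement χ = ∑ i, Real.negMulLog (w χ i ^ 2) := by
    have he (i) : reducedState χ (a i) = (hpos.isSymmetric.eigenvalues rfl i : ℂ) • a i :=
      hpos.isSymmetric.apply_eigenvectorBasis rfl i
    rw [entanglement, vonNeumannEntropy_eq_sum hpos.isSymmetric a he]
    refine Finset.sum_congr rfl fun i _ => ?_
    rw [hw2, he, inner_smul_right, inner_self_eq_norm_sq_to_K, a.norm_eq_one]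
    simp
  have hψE : entanglement ψ ≤ ∑ i, Real.negMulLog (w ψ i ^ 2) := by
    simp only [hw2]
    exact vonNeumannEntropy_le_sum (isPositive_reducedState ψ) a
  -- Expand `⟨ψ|χ⟩` in the product basis and apply Cauchy–Schwarz over `B` for each fixed `i`.
  have hcos : Real.cos (dFS ψ χ) ≤ ∑ i, w ψ i * w χ i := by
    rw [cos_dFS hψ hχ, ← (a.tensorProduct b).sum_inner_mul_inner ψ χ, Fintype.sum_prod_type]
    refine (norm_sum_le _ _).trans (Finset.sum_le_sum fun i _ => (norm_sum_le _ _).trans ?_)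
    simp only [w, inner_reducedState_self b, norm_mul, OrthonormalBasis.tensorProduct_apply]
    simp only [norm_inner_symm ψ]
    exact Real.sum_mul_le_sqrt_mul_sqrt _ _ _
  have := sum_negMulLog_sq_sub_le (fun i => Real.sqrt_nonneg _) (fun i => Real.sqrt_nonneg _)
    (hwsum ψ hψ) (hwsum χ hχ) (dFS_nonneg ψ χ) hcos
  rw [Fintype.card_fin] at this
  linarith

theorem entanglement_sub_le {ψ χ : A ⊗[ℂ] B} (hψ : ‖ψ‖ = 1) (hχ : ‖χ‖ = 1) :
    entanglement ψ - entanglement χ ≤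
      40 * dFS ψ χ * Real.log (min (Module.finrank ℂ A) (Module.finrank ℂ B) : ℕ) := by
  rcases min_choice (Module.finrank ℂ A) (Module.finrank ℂ B) with h | h
  · rw [h]
    exact entanglement_sub_le_finrank_left hψ hχ
  · have := entanglement_sub_le_finrank_left (ψ := TensorProduct.comm ℂ A B ψ)
      (χ := TensorProduct.comm ℂ A B χ) (by simpa using hψ) (by simpa using hχ)
    rwa [entanglement_comm, entanglement_comm, dFS, TensorProduct.inner_comm_comm,
      TensorProduct.norm_comm, TensorProduct.norm_comm, ← dFS, ← h] at this

theorem abs_dE_sub_dE_le {ψ χ φ : A ⊗[ℂ] B} (hψ : ‖ψ‖ = 1) (hχ : ‖χ‖ = 1) (hφ : ‖φ‖ = 1) :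
    |dE ψ φ - dE χ φ| ≤ dFS ψ χ + 40 * dFS ψ χ *
      Real.log (min (Module.finrank ℂ A) (Module.finrank ℂ B) : ℕ) := by
  refine (abs_sqrt_sq_add_sq_sub_le _ _ _ _).trans (add_le_add ?_ ?_)
  · have h1 := dFS_triangle hψ hχ hφ
    have h2 := dFS_triangle hχ hψ hφ
    rw [dFS_comm χ ψ] at h2
    rw [abs_le]
    constructor <;> linarith
  · refine (abs_abs_sub_abs_le _ _).trans ?_
    rw [sub_sub_sub_cancel_right]
    have h := entanglement_sub_le hχ hψ
    rw [dFS_comm] at h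
    exact abs_le.2 ⟨by linarith, entanglement_sub_le hψ hχ⟩

end ReducedState

end QuantumDistance

open scoped TensorProduct in
theorem mainTheorem9 :
    ∃ C : ℝ, 0 < C ∧
      ∀ (A : Type*) (B : Type*)
        [NormedAddCommGroup A] [InnerProductSpace ℂ A] [FiniteDimensional ℂ A]
        [NormedAddCommGroup B] [InnerProductSpace ℂ B] [FiniteDimensional ℂ B],
        (∀ ψ χ φ : A ⊗[ℂ] B, ‖ψ‖ = 1 → ‖χ‖ = 1 → ‖φ‖ = 1 →
          |QuantumDistance.dE ψ φ - QuantumDistance.dE χ φ| ≤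
            QuantumDistance.dFS ψ χ + C * QuantumDistance.dFS ψ χ *
              Real.log (min (Module.finrank ℂ A) (Module.finrank ℂ B) : ℕ)) ∧
        (∃ K : ℝ, 0 ≤ K ∧ ∀ ψ χ φ : A ⊗[ℂ] B, ‖ψ‖ = 1 → ‖χ‖ = 1 → ‖φ‖ = 1 →
          |QuantumDistance.dE ψ φ - QuantumDistance.dE χ φ| ≤
            K * QuantumDistance.dFS ψ χ) := by
  refine ⟨40, by norm_num, fun A B => ?_⟩
  intro _ _ _ _ _ _
  -- The witness left to unification is `K = 1 + 40 log d`; it is nonnegative even for `d = 0`,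
  -- since `Real.log 0 = 0`.
  refine ⟨fun ψ χ φ => QuantumDistance.abs_dE_sub_dE_le, _,
    add_nonneg zero_le_one (mul_nonneg (by norm_num : (0 : ℝ) ≤ 40) (Real.log_natCast_nonneg
      (min (Module.finrank ℂ A) (Module.finrank ℂ B)))), fun ψ χ φ hψ hχ hφ => ?_⟩
  refine (QuantumDistance.abs_dE_sub_dE_le hψ hχ hφ).trans_eq ?_
  ring
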